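/- Let $\varepsilon_0,\mu_0,\alpha,\beta,\gamma,\eta>0$, let $$\varepsilon(\omega,k)=\varepsilon_0+\frac{\alpha}{\beta-\omega^2+\eta k^2-i\gamma\omega},\qquad \xi(\omega,k)=\mu_0\bigl(\varepsilon(\omega,k)-\varepsilon_0\bigr)\qquad(\omega,k\in\mathbb C),$$ and write $k_0=k_0(\omega)=\omega\varepsilon_0\mu_0$ for the background wavenumber. Let $G(x,\kappa)=-\dfrac{e^{i\kappa|x|}}{4\pi|x|}$ be the outgoing Helmholtz Green's function in $\mathbb R^3$, and for a bounded domain $E\subset\mathbb R^3$ define on $L^2(E)$ $$K_E^{\kappa}[u](x)=-\int_E G(x-y,\kappa)\,u(y)\,dy,\qquad K_E^{(2)}[u](x)=\frac1{8\pi}\int_E|x-y|\,u(y)\,dy,\qquad \langle f,g\rangle=\int_E f\,\overline g .$$ A pair $(\omega_s,k_s)\in\mathbb C^2$ is called a resonant frequency and associated wavenumber of a resonator occupying $\Omega$ if there is $u\in L^2(\Omega)$, $u\neq0$, with $u=\omega_s^2\,\xi(\omega_s,k_s)\,K_\Omega^{k_0(\omega_s)}[u]$ (poles of $\xi$ being excluded).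 Let $D\subset\mathbb R^3$ be a bounded domain, and let $\Omega=\delta D+z$ with $z\in\mathbb R^3$, $\delta>0$. For every $r>0$ there are $C,\delta_0>0$, depending only on $D$, $r$ and the constants $\varepsilon_0,\mu_0,\alpha,\beta,\gamma,\eta$, such that for all $0<\delta<\delta_0$, all $z$, and all resonant pairs $(\omega_s,k_s)$ of $\Omega$ with $\operatorname{Re}\omega_s\ge r$ and $|\omega_s|\le 1/r$, the following holds with $k_0=k_0(\omega_s)$. There are an eigenvalue $\lambda_\delta$ of $K_D^{\delta k_0}$ and an associated eigenvector $u_\delta\in L^2(D)$, $\|u_\delta\|_{L^2(D)}=1$, with $\delta^2\omega_s^2\xi(\omega_s,k_s)\lambda_\delta=1$. For every such pair $(\lambda_\delta,u_\delta)$ with $|\lambda_\delta|\ge r$, the resonant pair agrees up to $O(\delta^4)$ with a solution $(\omega,k)$ of the equation $$1-\delta^2\omega^2\xi(\omega,k)\,\lambda_\delta=-\delta^4k_0^2\,\omega^2\,\xi(\omega,k)\,\bigl\langle K_D^{(2)}[u_\delta],u_\delta\bigr\rangle ,$$ in which $k_0,\lambda_\delta,u_\delta$ are the data just fixed, in both of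 the following senses: (i) for the given wavenumber $k=k_s$ there is a solution $(\omega,k_s)$ with $|\omega-\omega_s|\le C\delta^4$; (ii) for the given frequency $\omega=\omega_s$, provided $|k_s|\ge r$, there is a solution $(\omega_s,k)$ with $|k-k_s|\le C\delta^4$. -/

import Mathlib

open MeasureTheory

noncomputable section

namespace Perovskite

/-- Three-dimensional Euclidean space. -/
abbrev E3 : Type := EuclideanSpace ℝ (Fin 3)

/-- The dispersion relation of a halide perovskite,
`ε(ω, k) = ε₀ + α / (β - ω² + η k² - i γ ω)`. -/
def permittivity (ε₀ α β γ η : ℝ) (ω k : ℂ) : ℂ :=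
  ε₀ + α / (β - ω ^ 2 + η * k ^ 2 - Complex.I * γ * ω)

/-- The permittivity contrast `ξ(ω, k) = μ₀ (ε(ω, k) - ε₀)`. If `(ω, k)` is a pole of the
permittivity, the value here is `0`, so that poles satisfy neither the resonance condition nor the
approximate equation below. -/
def contrast (ε₀ μ₀ α β γ η : ℝ) (ω k : ℂ) : ℂ :=
  μ₀ * (permittivity ε₀ α β γ η ω k - ε₀)

/-- The background wavenumber `k₀ = ω ε₀ μ₀`. -/
def backgroundWavenumber (ε₀ μ₀ : ℝ) (ω : ℂ) : ℂ :=
  ω * ε₀ * μ₀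

/-- The outgoing Helmholtz Green's function in dimension three,
`G(x, κ) = - e^{iκ|x|} / (4π|x|)`. -/
def helmholtzGreen (x : E3) (κ : ℂ) : ℂ :=
  -(Complex.exp (Complex.I * κ * (‖x‖ : ℂ)) / (4 * (Real.pi : ℂ) * (‖x‖ : ℂ)))

/-- The Newtonian-type operator `K_D^κ[u](x) = - ∫_D G(x - y, κ) u(y) dy`. -/
def newtonOp (D : Set E3) (κ : ℂ) (u : E3 → ℂ) (x : E3) : ℂ :=
  -∫ y in D, helmholtzGreen (x - y) κ * u y

/-- For `n ≥ 1`, the operator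
`K_D^{(n)}[u](x) = -(i / 4π) ∫_D (i|x - y|)^{n-1} / n! u(y) dy`. -/
def expansionOp (D : Set E3) (n : ℕ) (u : E3 → ℂ) (x : E3) : ℂ :=
  -(Complex.I / (4 * (Real.pi : ℂ))) *
    ∫ y in D, (Complex.I * (‖x - y‖ : ℂ)) ^ (n - 1) / (n.factorial : ℂ) * u y

/-- The `L²(D)` inner product `⟨f, g⟩ = ∫_D f(x) \overline{g(x)} dx`. -/
def innerL2 (D : Set E3) (f g : E3 → ℂ) : ℂ :=
  ∫ x in D, f x * (starRingEnd ℂ) (g x)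

/-- `lam` is an eigenvalue of `K_D^κ : L²(D) → L²(D)`, and `u` is an associated eigenvector of
norm one. -/
structure IsNormalizedEigenpair (D : Set E3) (κ lam : ℂ) (u : E3 → ℂ) : Prop where
  memLp : MemLp u 2 (volume.restrict D)
  norm_eq_one : innerL2 D u u = 1
  eigen : ∀ᵐ x ∂(volume.restrict D), newtonOp D κ u x = lam * u x

/-- `(ω, k)` is a resonant frequency with associated wavenumber for the resonator occupying `Ω`:
the operator `I - ω² ξ(ω, k) K_Ω^{k₀}` on `L²(Ω)`, with `k₀ = ω ε₀ μ₀`, has a nontrivial kernel,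
that is, the Lippmann-Schwinger equation without incident field has a nontrivial solution. -/
def IsResonant (ε₀ μ₀ α β γ η : ℝ) (Ω : Set E3) (ω k : ℂ) : Prop :=
  ∃ u : E3 → ℂ, MemLp u 2 (volume.restrict Ω) ∧
    (¬ ∀ᵐ x ∂(volume.restrict Ω), u x = 0) ∧
    ∀ᵐ x ∂(volume.restrict Ω),
      u x - ω ^ 2 * contrast ε₀ μ₀ α β γ η ω k *
        newtonOp Ω (backgroundWavenumber ε₀ μ₀ ω) u x = 0

/-- The small resonator `δ D + z`. -/
def resonator (D : Set E3) (δ : ℝ) (z : E3) : Set E3 :=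
  (fun x : E3 => δ • x + z) '' D

/-- The approximate equation
`1 - δ² ω² ξ(ω, k) λ = - δ⁴ k₀² ω² ξ(ω, k) ⟨K_D^{(2)}[u], u⟩` for `(ω, k)`, with given background
wavenumber `k₀` and given eigenpair `(λ, u)`. -/
def SatisfiesApproxEq (ε₀ μ₀ α β γ η : ℝ) (D : Set E3) (δ : ℝ) (k₀ lam : ℂ) (u : E3 → ℂ)
    (ω k : ℂ) : Prop :=
  1 - (δ : ℂ) ^ 2 * ω ^ 2 * contrast ε₀ μ₀ α β γ η ω k * lam =
    -((δ : ℂ) ^ 4 * k₀ ^ 2 * ω ^ 2 * contrast ε₀ μ₀ α β γ η ω k *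
      innerL2 D (expansionOp D 2 u) u)

end Perovskite

end

/-!
Away from poles the contrast is `ξ = μ₀ α / P` with `P(ω, k) = β - ω² + η k² - i γ ω`, so after
clearing the denominator the resonance condition `δ² ω² ξ λ = 1` and the approximate equation become
`P(ω, k) = μ₀ α ω² δ² λ` and `P(ω, k) = μ₀ α ω² δ² (λ - δ² k₀² I)`, where `I = ⟨K_D^{(2)}[u], u⟩`
(`contrast_mul_eq_one` and `satisfiesApproxEq_of_dispersion_eq`). Each is a quadratic equation in
`ω` and in `k`, and the right-hand sides differ by `μ₀ α ω² δ⁴ k₀² I = O(δ⁴)`, so that a resonant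
pair satisfies the second equation up to `O(δ⁴)`.
If the derivative of a quadratic polynomial at a point is bounded below, then the polynomial has a
root within a multiple of its value there (`exists_quadratic_root_near`). In `ω` the derivative is
close to `2 ω_s + i γ`, whose real part is at least `2 r`; in `k` it is `2 η k_s`. The lower bound
`r ≤ |λ|` keeps `λ - δ² k₀² I` away from zero, so that the roots are not poles of the contrast.

For uniformity one needs `λ` and `I` bounded in terms of `D` and `r` only. Both are values
`⟨T u, u⟩` of integral operators with kernels bounded by a multiple of `1 / |x - y|` or by a
constant, so elementary `L²` estimates suffice, as `1 / |x|²` is locally integrable in dimension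
three (`exists_bound_newtonOp` and `exists_bound_eigenvalue_and_inner`).

The existence of `(λ, u)` is the scaling law `K_{δD+z}^{k₀}[u](δ x + z) = δ² K_D^{δ k₀}[v](x)`
with `v(x) = u(δ x + z)` (`newtonOp_resonator`).
-/

open MeasureTheory

namespace Perovskite

/-! ### Roots of quadratic polynomials -/

/-- The two roots `z₁, z₂` satisfy `a ((z₀ - z₁) + (z₀ - z₂)) = 2 a z₀ + b`, so that one of them is
at distance at least `m / (2 |a|)` from `z₀`, and then the other one is close to `z₀`. -/
theorem exists_quadratic_root_near {a b c z₀ : ℂ} {m : ℝ} (ha : a ≠ 0)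
    (hm : m ≤ ‖2 * a * z₀ + b‖) :
    ∃ z : ℂ, a * z ^ 2 + b * z + c = 0 ∧ m * ‖z - z₀‖ ≤ 2 * ‖a * z₀ ^ 2 + b * z₀ + c‖ := by
  obtain ⟨z₁, hz₁⟩ : ∃ z : ℂ, a * (z * z) + b * z + c = 0 := by
    obtain ⟨s, hs⟩ := IsAlgClosed.exists_pow_nat_eq (discrim a b c) (n := 2) two_pos
    exact exists_quadratic_eq_zero ha ⟨s, by rw [← hs, sq]⟩
  obtain ⟨z₂, hz₂⟩ : ∃ z₂ : ℂ, a * (z₁ + z₂) = -b :=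
    ⟨-b / a - z₁, by field_simp; ring⟩
  have hc : c = a * z₁ * z₂ := by linear_combination hz₁ - z₁ * hz₂
  have hfac : a * z₀ ^ 2 + b * z₀ + c = a * (z₁ - z₀) * (z₂ - z₀) := by
    linear_combination hc + z₀ * hz₂
  have hsum : 2 * a * z₀ + b = -(a * (z₁ - z₀) + a * (z₂ - z₀)) := by
    linear_combination hz₂
  have hm' : m ≤ ‖a‖ * ‖z₁ - z₀‖ + ‖a‖ * ‖z₂ - z₀‖ := by
    rw [hsum, norm_neg] at hm
    simpa only [norm_mul] using hm.trans (norm_add_le _ _)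
  have hn : ‖a * z₀ ^ 2 + b * z₀ + c‖ = ‖a‖ * ‖z₁ - z₀‖ * ‖z₂ - z₀‖ := by
    rw [hfac, norm_mul, norm_mul]
  rcases le_total ‖z₁ - z₀‖ ‖z₂ - z₀‖ with h | h
  · refine ⟨z₁, by linear_combination hz₁, ?_⟩
    have h1 := mul_le_mul_of_nonneg_right hm' (norm_nonneg (z₁ - z₀))
    have h2 := mul_le_mul_of_nonneg_left h (mul_nonneg (norm_nonneg a) (norm_nonneg (z₁ - z₀)))
    rw [hn]
    linarith
  · refine ⟨z₂, by linear_combination hc + z₂ * hz₂, ?_⟩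
    have h1 := mul_le_mul_of_nonneg_right hm' (norm_nonneg (z₂ - z₀))
    have h2 := mul_le_mul_of_nonneg_left h (mul_nonneg (norm_nonneg a) (norm_nonneg (z₂ - z₀)))
    rw [hn]
    linarith

/-! ### Clearing the denominator of the contrast -/

/-- The denominator `β - ω² + η k² - i γ ω` of the dispersion relation. -/
def dispersionDenom (β γ η : ℝ) (ω k : ℂ) : ℂ :=
  β - ω ^ 2 + η * k ^ 2 - Complex.I * γ * ω

theorem contrast_eq (ε₀ μ₀ α β γ η : ℝ) (ω k : ℂ) :
    contrast ε₀ μ₀ α β γ η ω k = μ₀ * α / dispersionDenom β γ η ω k := by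
  simp only [contrast, permittivity, dispersionDenom]
  ring

theorem contrast_mul_eq_one {ε₀ μ₀ α β γ η δ : ℝ} {ω k lam : ℂ}
    (h : (δ : ℂ) ^ 2 * ω ^ 2 * contrast ε₀ μ₀ α β γ η ω k * lam = 1) :
    dispersionDenom β γ η ω k = μ₀ * α * ω ^ 2 * δ ^ 2 * lam := by
  rw [contrast_eq] at h
  have hP : dispersionDenom β γ η ω k ≠ 0 := by
    intro h0
    simp [h0] at h
  field_simp at h
  linear_combination -h

theorem satisfiesApproxEq_of_dispersion_eq {ε₀ μ₀ α β γ η : ℝ} {D : Set E3} {δ : ℝ}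
    {k₀ lam : ℂ} {u : E3 → ℂ} {ω k : ℂ} (hμ₀ : μ₀ ≠ 0) (hα : α ≠ 0) (hδ : δ ≠ 0) (hω : ω ≠ 0)
    (hlam : lam - δ ^ 2 * k₀ ^ 2 * innerL2 D (expansionOp D 2 u) u ≠ 0)
    (h : dispersionDenom β γ η ω k =
      μ₀ * α * ω ^ 2 * δ ^ 2 * (lam - δ ^ 2 * k₀ ^ 2 * innerL2 D (expansionOp D 2 u) u)) :
    SatisfiesApproxEq ε₀ μ₀ α β γ η D δ k₀ lam u ω k := by
  have hP : dispersionDenom β γ η ω k ≠ 0 := by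
    rw [h]
    have : (μ₀ : ℂ) ≠ 0 := by exact_mod_cast hμ₀
    have : (α : ℂ) ≠ 0 := by exact_mod_cast hα
    have : (δ : ℂ) ≠ 0 := by exact_mod_cast hδ
    simp [*]
  rw [SatisfiesApproxEq, contrast_eq]
  field_simp
  linear_combination h

/-! ### Bounds for the integral operators -/

/-- The pointwise inequality `2 g |u| ≤ g² + |u|²` replaces Cauchy–Schwarz: for normalized `u` it
is all that is needed, and it requires no measurability of `f`. -/
theorem norm_setIntegral_mul_le {D : Set E3} (hD : MeasurableSet D) {f u : E3 → ℂ} {g : E3 → ℝ}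
    (hg : IntegrableOn (fun y => g y ^ 2) D) (hfg : ∀ y ∈ D, ‖f y‖ ≤ g y)
    (hu : MemLp u 2 (volume.restrict D)) :
    ‖∫ y in D, f y * u y‖ ≤ ((∫ y in D, g y ^ 2) + ∫ y in D, ‖u y‖ ^ 2) / 2 := by
  have hu2 : IntegrableOn (fun y => ‖u y‖ ^ 2) D := hu.integrable_norm_pow two_ne_zero
  rw [← integral_add hg hu2, ← integral_div]
  refine norm_integral_le_of_norm_le ((hg.add hu2).div_const 2) ?_
  filter_upwards [ae_restrict_mem hD] with y hy
  rw [norm_mul]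
  have h1 := mul_le_mul_of_nonneg_right (hfg y hy) (norm_nonneg (u y))
  have h2 := two_mul_le_add_sq (g y) ‖u y‖
  change ‖f y‖ * ‖u y‖ ≤ (g y ^ 2 + ‖u y‖ ^ 2) / 2
  linarith

theorem innerL2_self (D : Set E3) (u : E3 → ℂ) :
    innerL2 D u u = ((∫ x in D, ‖u x‖ ^ 2 : ℝ) : ℂ) := by
  rw [innerL2, ← integral_complex_ofReal]
  simp [Complex.mul_conj, Complex.normSq_eq_norm_sq]

theorem norm_innerL2_le {D : Set E3} (hD : MeasurableSet D) (hfin : volume D ≠ ⊤) {f u : E3 → ℂ}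
    {M : ℝ} (hf : ∀ x ∈ D, ‖f x‖ ≤ M) (hu : MemLp u 2 (volume.restrict D))
    (hu1 : innerL2 D u u = 1) :
    ‖innerL2 D f u‖ ≤ (M ^ 2 * volume.real D + 1) / 2 := by
  have hu1' : ∫ x in D, ‖u x‖ ^ 2 = 1 := by
    rw [innerL2_self] at hu1
    exact_mod_cast hu1
  have h := norm_setIntegral_mul_le (u := fun x => (starRingEnd ℂ) (u x)) hD
    (integrableOn_const hfin) hf hu.star
  simpa [innerL2, hu1', mul_comm] using h

theorem integrableOn_ball_inv_norm_sq (T : ℝ) :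
    IntegrableOn (fun x : E3 => (‖x‖ ^ 2)⁻¹) (Metric.ball 0 T) := by
  rw [integrableOn_fun_norm_addHaar (E := E3) volume (f := fun t : ℝ => (t ^ 2)⁻¹)]
  refine (integrableOn_const (C := (1 : ℝ)) (by simp)).congr_fun ?_ measurableSet_Ioo
  intro t ht
  have : t ≠ 0 := ht.1.ne'
  simp [this]

/-- Uniformity in `x` comes from translation invariance: the integral over `D` is at most the
integral over the ball of radius `T` around `x`. -/
theorem exists_bound_setIntegral_inv_norm_sq {D : Set E3} (hD : MeasurableSet D) {T : ℝ}
    (hT : ∀ x ∈ D, ∀ y ∈ D, ‖x - y‖ < T) :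
    ∃ J : ℝ, ∀ x ∈ D, IntegrableOn (fun y => (‖x - y‖ ^ 2)⁻¹) D ∧
      ∫ y in D, (‖x - y‖ ^ 2)⁻¹ ≤ J := by
  let F : E3 → ℝ := (Metric.ball 0 T).indicator fun x => (‖x‖ ^ 2)⁻¹
  have hF : Integrable F :=
    (integrable_indicator_iff measurableSet_ball).2 (integrableOn_ball_inv_norm_sq T)
  refine ⟨∫ x, F x, fun x hx => ?_⟩
  have hFx : Integrable fun y => F (x - y) := hF.comp_sub_left x
  have hEq : Set.EqOn (fun y => F (x - y)) (fun y => (‖x - y‖ ^ 2)⁻¹) D := fun y hy =>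
    Set.indicator_of_mem (by simpa using hT x hx y hy) _
  refine ⟨hFx.integrableOn.congr_fun hEq hD, ?_⟩
  rw [← setIntegral_congr_fun hD hEq, ← integral_sub_left_eq_self F volume x]
  refine setIntegral_le_integral hFx (.of_forall fun y => ?_)
  exact Set.indicator_nonneg (fun _ _ => by positivity) _

theorem norm_helmholtzGreen_le {T κmax : ℝ} {x : E3} {κ : ℂ} (hx : ‖x‖ ≤ T) (hκ : ‖κ‖ ≤ κmax) :
    ‖helmholtzGreen x κ‖ ≤ Real.exp (κmax * T) * ‖x‖⁻¹ := by
  have h1 : ‖Complex.exp (Complex.I * κ * (‖x‖ : ℂ))‖ ≤ Real.exp (κmax * T) := by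
    refine (Complex.norm_exp_le_exp_norm _).trans (Real.exp_le_exp.2 ?_)
    simp only [norm_mul, Complex.norm_I, one_mul, Complex.norm_real, norm_norm]
    exact mul_le_mul hκ hx (norm_nonneg _) ((norm_nonneg _).trans hκ)
  have h2 : (4 * Real.pi * ‖x‖)⁻¹ ≤ ‖x‖⁻¹ := by
    rw [mul_inv]
    refine mul_le_of_le_one_left (by positivity) (inv_le_one_of_one_le₀ ?_)
    linarith [Real.pi_gt_three]
  calc ‖helmholtzGreen x κ‖
      = ‖Complex.exp (Complex.I * κ * (‖x‖ : ℂ))‖ * (4 * Real.pi * ‖x‖)⁻¹ := by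
        simp [helmholtzGreen, div_eq_mul_inv, abs_of_pos Real.pi_pos]
    _ ≤ _ := mul_le_mul h1 h2 (by positivity) (Real.exp_nonneg _)

theorem exists_bound_newtonOp {D : Set E3} (hD : MeasurableSet D) {T : ℝ}
    (hT : ∀ x ∈ D, ∀ y ∈ D, ‖x - y‖ < T) (κmax : ℝ) :
    ∃ M : ℝ, ∀ (κ : ℂ) (u : E3 → ℂ), ‖κ‖ ≤ κmax → MemLp u 2 (volume.restrict D) →
      innerL2 D u u = 1 → ∀ x ∈ D, ‖newtonOp D κ u x‖ ≤ M := by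
  obtain ⟨J, hJ⟩ := exists_bound_setIntegral_inv_norm_sq hD hT
  refine ⟨(Real.exp (κmax * T) ^ 2 * J + 1) / 2, fun κ u hκ hu hu1 x hx => ?_⟩
  obtain ⟨hint, hle⟩ := hJ x hx
  have hu1' : ∫ x in D, ‖u x‖ ^ 2 = 1 := by
    rw [innerL2_self] at hu1
    exact_mod_cast hu1
  have hg : (fun y => (Real.exp (κmax * T) * ‖x - y‖⁻¹) ^ 2) =
      fun y => Real.exp (κmax * T) ^ 2 * (‖x - y‖ ^ 2)⁻¹ := by
    funext y
    rw [mul_pow, inv_pow]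
  have h := norm_setIntegral_mul_le (f := fun y => helmholtzGreen (x - y) κ)
    (g := fun y => Real.exp (κmax * T) * ‖x - y‖⁻¹) hD (by rw [hg]; exact hint.const_mul _)
    (fun y hy => norm_helmholtzGreen_le (hT x hx y hy).le hκ) hu
  rw [hg, integral_const_mul, hu1'] at h
  rw [newtonOp, norm_neg]
  refine h.trans ?_
  gcongr

theorem norm_expansionOp_two_le {D : Set E3} (hD : MeasurableSet D) (hfin : volume D ≠ ⊤) {T : ℝ}
    (hT : ∀ x ∈ D, ∀ y ∈ D, ‖x - y‖ < T) {u : E3 → ℂ} (hu : MemLp u 2 (volume.restrict D))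
    (hu1 : innerL2 D u u = 1) {x : E3} (hx : x ∈ D) :
    ‖expansionOp D 2 u x‖ ≤ (T ^ 2 * volume.real D + 1) / 2 := by
  have hu1' : ∫ x in D, ‖u x‖ ^ 2 = 1 := by
    rw [innerL2_self] at hu1
    exact_mod_cast hu1
  have h := norm_setIntegral_mul_le
    (f := fun y => (Complex.I * (‖x - y‖ : ℂ)) ^ (2 - 1) / (Nat.factorial 2 : ℂ))
    (g := fun _ => T) hD (integrableOn_const hfin) (fun y hy => by
      have := hT x hx y hy
      have := norm_nonneg (x - y)
      simp
      linarith) hu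
  rw [hu1', setIntegral_const, smul_eq_mul, mul_comm (volume.real D)] at h
  rw [expansionOp, norm_mul]
  refine (mul_le_of_le_one_left (norm_nonneg _) ?_).trans h
  have : 1 ≤ 4 * Real.pi := by linarith [Real.pi_gt_three]
  rw [norm_neg, norm_div, Complex.norm_I, norm_mul, Complex.norm_real, Complex.norm_ofNat,
    Real.norm_of_nonneg Real.pi_pos.le]
  exact div_le_one_of_le₀ this (by positivity)

/-- Uniformly for bounded wavenumbers `κ`, both the eigenvalues of `K_D^κ` and the quantities
`⟨K_D^{(2)}[u], u⟩` are bounded; an eigenvalue is `⟨K_D^κ[u], u⟩` for a normalized eigenvector. -/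
theorem exists_bound_eigenvalue_and_inner {D : Set E3} (hD : MeasurableSet D)
    (hD_bdd : Bornology.IsBounded D) (κmax : ℝ) :
    ∃ B > (0 : ℝ), ∀ (κ lam : ℂ) (u : E3 → ℂ), ‖κ‖ ≤ κmax → IsNormalizedEigenpair D κ lam u →
      ‖lam‖ ≤ B ∧ ‖innerL2 D (expansionOp D 2 u) u‖ ≤ B := by
  have hfin : volume D ≠ ⊤ := hD_bdd.measure_lt_top.ne
  obtain ⟨T, hT⟩ : ∃ T, ∀ x ∈ D, ∀ y ∈ D, ‖x - y‖ < T := by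
    obtain ⟨T, hT⟩ := Metric.isBounded_iff.1 hD_bdd
    exact ⟨T + 1, fun x hx y hy => by
      rw [← dist_eq_norm]
      linarith [hT hx hy]⟩
  obtain ⟨M, hM⟩ := exists_bound_newtonOp hD hT κmax
  set M₂ := (T ^ 2 * volume.real D + 1) / 2
  refine ⟨(M ^ 2 * volume.real D + 1) / 2 + (M₂ ^ 2 * volume.real D + 1) / 2, by positivity,
    fun κ lam u hκ h => ⟨?_, ?_⟩⟩
  · have hlam : lam = innerL2 D (newtonOp D κ u) u := by
      rw [← mul_one lam, ← h.norm_eq_one, innerL2, innerL2, ← integral_const_mul]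
      refine integral_congr_ae ?_
      filter_upwards [h.eigen] with x hx
      rw [hx, mul_assoc]
    have := norm_innerL2_le hD hfin (hM κ u hκ h.memLp h.norm_eq_one) h.memLp h.norm_eq_one
    rw [← hlam] at this
    exact this.trans (le_add_of_nonneg_right (by positivity))
  · have := norm_innerL2_le hD hfin
      (fun x hx => norm_expansionOp_two_le hD hfin hT h.memLp h.norm_eq_one hx)
      h.memLp h.norm_eq_one
    exact this.trans (le_add_of_nonneg_left (by positivity))

/-! ### Rescaling of the resonator -/

theorem measurableEmbedding_smul_add {δ : ℝ} (hδ : 0 < δ) (z : E3) :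
    MeasurableEmbedding fun x : E3 => δ • x + z :=
  ((Homeomorph.smulOfNeZero δ hδ.ne').trans (Homeomorph.addRight z)).measurableEmbedding

theorem map_restrict_smul_add {δ : ℝ} (hδ : 0 < δ) (z : E3) (D : Set E3) :
    Measure.map (fun x : E3 => δ • x + z) (volume.restrict D) =
      ENNReal.ofReal (δ ^ 3)⁻¹ • volume.restrict (resonator D δ z) := by
  have he := measurableEmbedding_smul_add hδ z
  have hmap : Measure.map (fun x : E3 => δ • x + z) volume =
      ENNReal.ofReal (δ ^ 3)⁻¹ • (volume : Measure E3) := by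
    have h1 := Measure.map_addHaar_smul (volume : Measure E3) hδ.ne'
    rw [finrank_euclideanSpace_fin, abs_of_pos (by positivity)] at h1
    have h2 : Measure.map (fun x : E3 => x + z) (Measure.map (fun x : E3 => δ • x) volume) =
        Measure.map (fun x : E3 => δ • x + z) volume :=
      Measure.map_map (by fun_prop) (by fun_prop)
    rw [← h2, h1, Measure.map_smul, map_add_right_eq_self]
  rw [resonator, ← Measure.restrict_smul, ← hmap, he.restrict_map,
    Set.preimage_image_eq _ he.injective]

theorem helmholtzGreen_smul {δ : ℝ} (hδ : 0 < δ) (x : E3) (κ : ℂ) :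
    helmholtzGreen (δ • x) κ = (δ : ℂ)⁻¹ * helmholtzGreen x (δ * κ) := by
  simp only [helmholtzGreen, norm_smul, Real.norm_of_nonneg hδ.le, Complex.ofReal_mul]
  rw [show Complex.I * κ * (↑δ * (‖x‖ : ℂ)) = Complex.I * (↑δ * κ) * (‖x‖ : ℂ) by ring]
  simp only [div_eq_mul_inv, mul_inv]
  ring

/-- Rescaling the domain by `δ` in dimension three multiplies the Newtonian operator by
`δ² = δ³ · δ⁻¹`, from the volume element and the singularity of the kernel. -/
theorem newtonOp_resonator {δ : ℝ} (hδ : 0 < δ) (z : E3) (D : Set E3) (κ : ℂ) (u : E3 → ℂ)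
    (x : E3) :
    newtonOp (resonator D δ z) κ u (δ • x + z) =
      (δ : ℂ) ^ 2 * newtonOp D (δ * κ) (fun y => u (δ • y + z)) x := by
  have hδ' : (δ : ℂ) ≠ 0 := by exact_mod_cast hδ.ne'
  have h := (measurableEmbedding_smul_add hδ z).integral_map (μ := volume.restrict D)
    (fun y => helmholtzGreen (δ • x + z - y) κ * u y)
  have hker : ∀ y : E3, helmholtzGreen (δ • x + z - (δ • y + z)) κ =
      (δ : ℂ)⁻¹ * helmholtzGreen (x - y) (δ * κ) := fun y => by
    rw [← helmholtzGreen_smul hδ, smul_sub, add_sub_add_right_eq_sub]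
  simp only [hker, mul_assoc] at h
  rw [map_restrict_smul_add hδ, integral_smul_measure, integral_const_mul,
    ENNReal.toReal_ofReal (by positivity), Complex.real_smul] at h
  push_cast at h
  rw [newtonOp, newtonOp]
  field_simp at h
  linear_combination -h

theorem exists_isNormalizedEigenpair {D : Set E3} {κ lam : ℂ} {v : E3 → ℂ}
    (hv : MemLp v 2 (volume.restrict D)) (hv0 : ¬ ∀ᵐ x ∂(volume.restrict D), v x = 0)
    (heig : ∀ᵐ x ∂(volume.restrict D), newtonOp D κ v x = lam * v x) :
    ∃ u, IsNormalizedEigenpair D κ lam u := by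
  have hint : IntegrableOn (fun x => ‖v x‖ ^ 2) D := hv.integrable_norm_pow two_ne_zero
  set N : ℝ := ∫ x in D, ‖v x‖ ^ 2
  have hN : 0 < N := by
    refine (integral_nonneg fun x => by positivity).lt_of_ne' fun h0 => hv0 ?_
    have := (integral_eq_zero_iff_of_nonneg (fun x => by positivity) hint).1 h0
    filter_upwards [this] with x hx
    simpa using hx
  set c : ℂ := (((Real.sqrt N)⁻¹ : ℝ) : ℂ)
  refine ⟨fun x => c * v x, hv.const_mul c, ?_, ?_⟩
  · rw [innerL2_self]
    have : ∫ x in D, ‖c * v x‖ ^ 2 = 1 := by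
      simp only [norm_mul, mul_pow, integral_const_mul]
      have : ‖c‖ ^ 2 = N⁻¹ := by
        rw [Complex.norm_real, Real.norm_eq_abs, sq_abs, inv_pow, Real.sq_sqrt hN.le]
      rw [this]
      exact inv_mul_cancel₀ hN.ne'
    rw [this, Complex.ofReal_one]
  · filter_upwards [heig] with x hx
    have : newtonOp D κ (fun y => c * v y) x = c * newtonOp D κ v x := by
      simp only [newtonOp, mul_left_comm _ c, integral_const_mul, mul_neg]
    rw [this, hx, mul_left_comm]

theorem exists_eigenpair_of_isResonant {ε₀ μ₀ α β γ η : ℝ} {D : Set E3} {δ : ℝ} (hδ : 0 < δ)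
    {z : E3} {ω k : ℂ} (h : IsResonant ε₀ μ₀ α β γ η (resonator D δ z) ω k) :
    ∃ (lam : ℂ) (u : E3 → ℂ),
      IsNormalizedEigenpair D ((δ : ℂ) * backgroundWavenumber ε₀ μ₀ ω) lam u ∧
      (δ : ℂ) ^ 2 * ω ^ 2 * contrast ε₀ μ₀ α β γ η ω k * lam = 1 := by
  obtain ⟨u, hu, hu0, heq⟩ := h
  have he := measurableEmbedding_smul_add hδ z
  have hc : ENNReal.ofReal (δ ^ 3)⁻¹ ≠ 0 := by
    rw [Ne, ENNReal.ofReal_eq_zero, not_le]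
    positivity
  have hmap := map_restrict_smul_add hδ z D
  have hae : ∀ p : E3 → Prop, (∀ᵐ x ∂(volume.restrict D), p (δ • x + z)) ↔
      ∀ᵐ y ∂(volume.restrict (resonator D δ z)), p y := fun p => by
    rw [← he.ae_map_iff, hmap, Measure.ae_ennreal_smul_measure_iff hc]
  have hv : MemLp (fun x => u (δ • x + z)) 2 (volume.restrict D) := by
    have := hu.smul_measure (c := ENNReal.ofReal (δ ^ 3)⁻¹) ENNReal.ofReal_ne_top
    rw [← hmap, he.memLp_map_measure_iff] at this
    exact this
  set s : ℂ := ω ^ 2 * contrast ε₀ μ₀ α β γ η ω k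
  have hs : s ≠ 0 := by
    intro h0
    apply hu0
    filter_upwards [heq] with x hx
    simpa [h0] using hx
  have hδ' : (δ : ℂ) ≠ 0 := by exact_mod_cast hδ.ne'
  obtain ⟨w, hw⟩ := exists_isNormalizedEigenpair (κ := δ * backgroundWavenumber ε₀ μ₀ ω)
    (lam := (δ ^ 2 * s)⁻¹) hv (by rwa [hae fun y => u y = 0]) (by
      filter_upwards [(hae _).2 heq] with x hx
      rw [newtonOp_resonator hδ] at hx
      field_simp
      linear_combination -hx)
  refine ⟨_, w, hw, ?_⟩
  rw [mul_assoc ((δ : ℂ) ^ 2)]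
  exact mul_inv_cancel₀ (mul_ne_zero (pow_ne_zero 2 hδ') hs)

end Perovskite

/-! ### Approximation of resonant pairs -/

open Perovskite

theorem mainTheorem1
    (ε₀ μ₀ α β γ η : ℝ) (hε₀ : 0 < ε₀) (hμ₀ : 0 < μ₀) (hα : 0 < α) (hβ : 0 < β) (hγ : 0 < γ)
    (hη : 0 < η)
    (D : Set Perovskite.E3) (hD_open : IsOpen D) (hD_conn : IsConnected D)
    (hD_bdd : Bornology.IsBounded D)
    (r : ℝ) (hr : 0 < r) :
    ∃ C > (0 : ℝ), ∃ δ₀ > (0 : ℝ), ∀ δ : ℝ, 0 < δ → δ < δ₀ → ∀ (z : Perovskite.E3) (ωs ks : ℂ),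
      r ≤ ωs.re → ‖ωs‖ ≤ r⁻¹ →
      Perovskite.IsResonant ε₀ μ₀ α β γ η (Perovskite.resonator D δ z) ωs ks →
      -- a resonance comes from an eigenpair `(λ_δ, u_δ)` of `K_D^{δ k₀}`
      (∃ (lam : ℂ) (u : Perovskite.E3 → ℂ),
        Perovskite.IsNormalizedEigenpair D
          ((δ : ℂ) * Perovskite.backgroundWavenumber ε₀ μ₀ ωs) lam u ∧
        (δ : ℂ) ^ 2 * ωs ^ 2 * Perovskite.contrast ε₀ μ₀ α β γ η ωs ks * lam = 1) ∧
      -- and for every such eigenpair, with eigenvalue away from zero: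
      ∀ (lam : ℂ) (u : Perovskite.E3 → ℂ),
        Perovskite.IsNormalizedEigenpair D
          ((δ : ℂ) * Perovskite.backgroundWavenumber ε₀ μ₀ ωs) lam u →
        (δ : ℂ) ^ 2 * ωs ^ 2 * Perovskite.contrast ε₀ μ₀ α β γ η ωs ks * lam = 1 →
        r ≤ ‖lam‖ →
        -- at the given wavenumber, the frequency is approximated up to `O(δ⁴)`
        (∃ ω : ℂ, ‖ω - ωs‖ ≤ C * δ ^ 4 ∧
          Perovskite.SatisfiesApproxEq ε₀ μ₀ α β γ η D δ
            (Perovskite.backgroundWavenumber ε₀ μ₀ ωs) lam u ω ks) ∧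
        -- at the given frequency, the wavenumber is approximated up to `O(δ⁴)`
        (r ≤ ‖ks‖ → ∃ k : ℂ, ‖k - ks‖ ≤ C * δ ^ 4 ∧
          Perovskite.SatisfiesApproxEq ε₀ μ₀ α β γ η D δ
            (Perovskite.backgroundWavenumber ε₀ μ₀ ωs) lam u ωs k) := by
  have hD := hD_open.measurableSet
  set κ : ℝ := r⁻¹ * ε₀ * μ₀ with hκ
  obtain ⟨B, hB, hbound⟩ := exists_bound_eigenvalue_and_inner hD hD_bdd κ
  have hκ0 : 0 < κ := by positivity
  set A : ℝ := μ₀ * α with hA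
  have hA0 : 0 < A := by positivity
  -- `Q δ⁴` bounds the defect of the approximate equation at the resonant pair, and `L` bounds
  -- the perturbed eigenvalue `lam - δ² k₀² ⟨K_D^{(2)}[u], u⟩`
  set Q : ℝ := A * r⁻¹ ^ 2 * (κ ^ 2 * B) with hQ
  have hQ0 : 0 < Q := by positivity
  set L : ℝ := B + κ ^ 2 * B with hL
  have hL0 : 0 < L := by positivity
  set C : ℝ := 2 * Q / r + Q / (η * r) with hC
  have hC0 : 0 < C := by positivity
  -- as `δ² ≤ δ` and `δ⁴ ≤ δ`, each smallness condition on `δ` follows from `δ t < 1` for one of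
  -- the summands `t` of `N`
  set N : ℝ := 1 + 2 * A * L / r ^ 2 + 2 * A * L + κ ^ 2 * B / r + C / r with hN
  have hN0 : 0 < N := by positivity
  refine ⟨C, hC0, N⁻¹, inv_pos.2 hN0, fun δ hδ hδN z ωs ks hre hnorm hres =>
    ⟨exists_eigenpair_of_isResonant hδ hres, fun lam u hpair heq hlam => ?_⟩⟩
  have hδN' : δ * N < 1 := by
    rwa [← one_div, lt_div_iff₀ hN0] at hδN
  have t1 : 0 < δ * (2 * A * L / r ^ 2) := by positivity
  have t2 : 0 < δ * (2 * A * L) := by positivity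
  have t3 : 0 < δ * (κ ^ 2 * B / r) := by positivity
  have t4 : 0 < δ * (C / r) := by positivity
  have hsum : δ + δ * (2 * A * L / r ^ 2) + δ * (2 * A * L) + δ * (κ ^ 2 * B / r) + δ * (C / r)
      < 1 := by
    rw [hN] at hδN'
    linarith
  have hδ1 : δ < 1 := by linarith
  have hδ2 : δ ^ 2 ≤ δ := pow_le_of_le_one hδ.le hδ1.le two_ne_zero
  have hδ4 : δ ^ 4 ≤ δ := pow_le_of_le_one hδ.le hδ1.le four_ne_zero
  have s1 : A * δ ^ 2 * L ≤ r ^ 2 / 2 := by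
    have : δ * (2 * A * L / r ^ 2) < 1 := by linarith
    rw [← mul_div_assoc, div_lt_one (by positivity)] at this
    have := mul_le_mul_of_nonneg_left hδ2 (mul_pos hA0 hL0).le
    linarith
  have s2 : A * δ ^ 2 * L < 1 := by
    have := mul_le_mul_of_nonneg_left hδ2 (mul_pos hA0 hL0).le
    linarith
  have s3 : δ ^ 2 * (κ ^ 2 * B) < r := by
    have : δ * (κ ^ 2 * B / r) < 1 := by linarith
    rw [← mul_div_assoc, div_lt_one hr] at this
    exact (mul_le_mul_of_nonneg_right hδ2 (by positivity)).trans_lt this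
  have s4 : C * δ ^ 4 < r := by
    have : δ * (C / r) < 1 := by linarith
    rw [← mul_div_assoc, div_lt_one hr] at this
    have := mul_le_mul_of_nonneg_left hδ4 hC0.le
    linarith
  set k₀ := backgroundWavenumber ε₀ μ₀ ωs with hk₀
  have hk₀n : ‖k₀‖ ≤ κ := by
    rw [hκ, hk₀, backgroundWavenumber, norm_mul, norm_mul, Complex.norm_real, Complex.norm_real,
      Real.norm_of_nonneg hε₀.le, Real.norm_of_nonneg hμ₀.le]
    gcongr
  have hδn : ‖(δ : ℂ)‖ = δ := by rw [Complex.norm_real, Real.norm_of_nonneg hδ.le]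
  have hAn : ‖(A : ℂ)‖ = A := by rw [Complex.norm_real, Real.norm_of_nonneg hA0.le]
  have hAc : (A : ℂ) = μ₀ * α := by rw [hA, Complex.ofReal_mul]
  obtain ⟨hlamB, hIB⟩ := hbound _ lam u (by
    rw [norm_mul, hδn]
    exact (mul_le_of_le_one_left (norm_nonneg _) hδ1.le).trans hk₀n) hpair
  set I := innerL2 D (expansionOp D 2 u) u with hI
  set Λ : ℂ := lam - δ ^ 2 * k₀ ^ 2 * I with hΛ
  have hkI : ‖k₀ ^ 2 * I‖ ≤ κ ^ 2 * B := by
    rw [norm_mul, norm_pow]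
    exact mul_le_mul (pow_le_pow_left₀ (norm_nonneg _) hk₀n 2) hIB (norm_nonneg _) (sq_nonneg _)
  have hpert : ‖(δ : ℂ) ^ 2 * k₀ ^ 2 * I‖ ≤ δ ^ 2 * (κ ^ 2 * B) := by
    rw [mul_assoc, norm_mul, norm_pow, hδn]
    exact mul_le_mul_of_nonneg_left hkI (sq_nonneg δ)
  have hΛ0 : Λ ≠ 0 := by
    intro h0
    rw [hΛ, sub_eq_zero] at h0
    rw [h0] at hlam
    linarith
  have hΛL : ‖Λ‖ ≤ L := by
    refine (norm_sub_le _ _).trans (add_le_add hlamB (hpert.trans ?_))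
    exact mul_le_of_le_one_left (by positivity) (by linarith)
  have hdisp := contrast_mul_eq_one heq
  have hωs0 : ωs ≠ 0 := by
    rintro rfl
    simp at hre
    linarith
  -- the defect of the approximate equation at the resonant pair
  have hdef : ‖(A : ℂ) * ωs ^ 2 * δ ^ 4 * (k₀ ^ 2 * I)‖ ≤ Q * δ ^ 4 := by
    rw [norm_mul, norm_mul, norm_mul, norm_pow, norm_pow, hδn, hAn, hQ]
    calc A * ‖ωs‖ ^ 2 * δ ^ 4 * ‖k₀ ^ 2 * I‖ ≤ A * r⁻¹ ^ 2 * δ ^ 4 * (κ ^ 2 * B) := by gcongr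
      _ = _ := by ring
  constructor
  · have hsmall : ‖(A : ℂ) * δ ^ 2 * Λ‖ ≤ A * δ ^ 2 * L := by
      rw [norm_mul, norm_mul, norm_pow, hδn, hAn]
      gcongr
    have ha : 1 + (A : ℂ) * δ ^ 2 * Λ ≠ 0 := by
      intro h0
      rw [eq_neg_of_add_eq_zero_right h0, norm_neg, norm_one] at hsmall
      linarith
    -- the real part of `iγ` vanishes, and that of `2 ωs` is at least `2 r`
    have hder : r ≤ ‖2 * (1 + (A : ℂ) * δ ^ 2 * Λ) * ωs + Complex.I * γ‖ := by
      have h1 : ‖2 * ((A : ℂ) * δ ^ 2 * Λ * ωs)‖ ≤ r := by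
        rw [norm_mul, norm_mul, Complex.norm_ofNat]
        calc 2 * (‖(A : ℂ) * δ ^ 2 * Λ‖ * ‖ωs‖) ≤ 2 * (r ^ 2 / 2 * r⁻¹) := by
              gcongr
              exact hsmall.trans s1
          _ = r := by field_simp
      have h2 : (2 * (1 + (A : ℂ) * δ ^ 2 * Λ) * ωs + Complex.I * γ).re =
          2 * ωs.re + (2 * ((A : ℂ) * δ ^ 2 * Λ * ωs)).re := by
        have : 2 * (1 + (A : ℂ) * δ ^ 2 * Λ) * ωs + Complex.I * γ =
            (2 : ℝ) * ωs + 2 * ((A : ℂ) * δ ^ 2 * Λ * ωs) + Complex.I * γ := by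
          push_cast
          ring
        rw [this, Complex.add_re, Complex.add_re, Complex.re_ofReal_mul]
        simp
      have h3 := (abs_le.1 ((Complex.abs_re_le_norm _).trans h1)).1
      have h4 := Complex.re_le_norm (2 * (1 + (A : ℂ) * δ ^ 2 * Λ) * ωs + Complex.I * γ)
      linarith
    obtain ⟨ω, hω, hωle⟩ := exists_quadratic_root_near (c := -(β + η * ks ^ 2)) ha hder
    have hval : (1 + (A : ℂ) * δ ^ 2 * Λ) * ωs ^ 2 + Complex.I * γ * ωs + -(β + η * ks ^ 2) =
        -((A : ℂ) * ωs ^ 2 * δ ^ 4 * (k₀ ^ 2 * I)) := by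
      rw [dispersionDenom, ← hAc] at hdisp
      rw [hΛ]
      linear_combination -hdisp
    rw [hval, norm_neg] at hωle
    have hclose : ‖ω - ωs‖ ≤ C * δ ^ 4 := by
      have h1 : ‖ω - ωs‖ ≤ 2 * Q / r * δ ^ 4 := by
        rw [div_mul_eq_mul_div, le_div_iff₀ hr]
        linarith
      refine h1.trans (mul_le_mul_of_nonneg_right ?_ (by positivity))
      exact le_add_of_nonneg_right (by positivity)
    refine ⟨ω, hclose, satisfiesApproxEq_of_dispersion_eq hμ₀.ne' hα.ne' hδ.ne' ?_ hΛ0 ?_⟩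
    · rintro rfl
      rw [zero_sub, norm_neg] at hclose
      linarith [Complex.re_le_norm ωs]
    · rw [dispersionDenom, ← hAc]
      linear_combination -hω
  · intro hks
    have hηc : (η : ℂ) ≠ 0 := by exact_mod_cast hη.ne'
    have hder : 2 * (η * r) ≤ ‖2 * (η : ℂ) * ks + 0‖ := by
      rw [add_zero, norm_mul, norm_mul, Complex.norm_real, Real.norm_of_nonneg hη.le,
        Complex.norm_ofNat, mul_assoc]
      exact mul_le_mul_of_nonneg_left (mul_le_mul_of_nonneg_left hks hη.le) two_pos.le
    obtain ⟨k, hk, hkle⟩ := exists_quadratic_root_near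
      (c := β - ωs ^ 2 - Complex.I * γ * ωs - A * ωs ^ 2 * δ ^ 2 * Λ) hηc hder
    have hval : (η : ℂ) * ks ^ 2 + 0 * ks +
        (β - ωs ^ 2 - Complex.I * γ * ωs - A * ωs ^ 2 * δ ^ 2 * Λ) =
        (A : ℂ) * ωs ^ 2 * δ ^ 4 * (k₀ ^ 2 * I) := by
      rw [dispersionDenom, ← hAc] at hdisp
      rw [hΛ]
      linear_combination hdisp
    rw [hval] at hkle
    refine ⟨k, ?_, satisfiesApproxEq_of_dispersion_eq hμ₀.ne' hα.ne' hδ.ne' hωs0 hΛ0 ?_⟩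
    · have h1 : ‖k - ks‖ ≤ Q / (η * r) * δ ^ 4 := by
        rw [div_mul_eq_mul_div, le_div_iff₀ (by positivity)]
        linarith
      refine h1.trans (mul_le_mul_of_nonneg_right ?_ (by positivity))
      exact le_add_of_nonneg_left (by positivity)
    · rw [dispersionDenom, ← hAc]
      linear_combination hk
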